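/- Let $K$ be a field and let $[X]$ be a cancellative commutative monoid, whose elements are called power-products (for instance all products of powers of $x_0,\dots,x_{n-1}$, or of infinitely many indeterminates), equipped with an admissible order $\preceq$, i.e. a linear order with least element $1$ such that $s\preceq t$ implies $su\preceq tu$. Let $K[X]$ be the $K$-algebra with basis $[X]$ (for the standard power-products, the polynomial ring). For a linearly ordered set $I$ of component indices let $K[X]^{I}$ be the free $K[X]$-module with basis $(e_i)_{i\in I}$ (for $I=\{0,\dots,k-1\}$ this is $K[X]^k$). Its terms $t\,e_i$ ($t\in[X]$, $i\in I$) are ordered by the position-over-term (POT) order: $s\,e_i\preceq_{\sf t}t\,e_j$ iff $i<j$, or $i=j$ and $s\preceq t$. For $f\neq 0$, the leading term $\mathrm{lt}(f)$ is the largest term occurring in $f$ with non-zero coefficient, and $\mathrm{lc}(f)$ is that coefficient. For a set $F$ write $p\to_F q$ if there are $f\in F\setminus\{0\}$ and $t\in[X]$ such that, with $\mathrm{lt}(f)=s\,e_j$, the coefficient $c$ of $(ts)\,e_j$ in $p$ is non-zero and $q=p-\frac{c}{\mathrm{lc}(f)}\,t\,f$. A set $G$ is a Gröbner basis if $\to_G$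 is confluent, i.e. if $p\to_G^*q$ and $p\to_G^*r$ imply that there is $z$ with $q\to_G^*z$ and $r\to_G^*z$. Let $bs=[b_0,\dots,b_{m-1}]$ be a list of pairwise distinct elements of $K[X]^{I}$. Its syzygy module is $\mathrm{Syz}(bs)=\{(s_0,\dots,s_{m-1})\in K[X]^m : \sum_{i<m}s_ib_i=0\}$. Let $I'$ consist of $m$ new indices $0<\dots<m-1$ followed by all the indices in $I$, so that $K[X]^{I'}=K[X]^m\oplus K[X]^I$, and let $bs'$ be the list of the vectors $(e_i,b_i)\in K[X]^{I'}$, $0\le i<m$. Let $gs$ be a finite list in $K[X]^{I'}$ that is a Gröbner basis with respect to the POT order and generates the same submodule of $K[X]^{I'}$ as $bs'$. Let $syz$ be the list of those $(s_0,\dots,s_{m-1})\in K[X]^m$ for which $(s_0,\dots,s_{m-1},0)$ occurs in $gs$. Then 1. $syz$ generates the submodule $\mathrm{Syz}(bs)$ of $K[X]^m$, and 2. $syz$ is a Gröbner basis with respect to the POT order on $K[X]^m$ extending $\preceq$. -/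

import Mathlib

/-!
Vectors of polynomials, term orders, polynomial reduction, Groebner bases and syzygies.

Power-products form a cancellative commutative monoid `α`, written additively, so that the ring of
polynomials over `K` is `AddMonoidAlgebra K α`; for `α = (σ →₀ ℕ)` this is `MvPolynomial σ K`.
Vector-polynomials with components indexed by `ι` are the elements of the free module
`ι →₀ AddMonoidAlgebra K α`; a term `t e_i` is the pair `(t, i) : α × ι`. The submodule generated
by a set `F` is `Submodule.span (AddMonoidAlgebra K α) F`.
-/

noncomputable section

namespace GB

/-- Admissible orders on power-products: linear orders for which the trivial power-product is
least and which are compatible with multiplication (written `+`). -/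
structure IsAdmissible {α : Type*} [AddCommMonoid α] (le : α → α → Prop) : Prop where
  refl : ∀ s, le s s
  antisymm : ∀ s t, le s t → le t s → s = t
  trans : ∀ s t u, le s t → le t u → le s u
  total : ∀ s t, le s t ∨ le t s
  zero_le : ∀ t, le 0 t
  add_mono : ∀ s t u, le s t → le (s + u) (t + u)

/-- The position-over-term extension of an order on power-products to an order on terms:
`s e_i ≼ t e_j` iff `i < j`, or `i = j` and `s ≼ t`. -/
def potLE {α ι : Type*} [LT ι] (le : α → α → Prop) (u v : α × ι) : Prop :=
  u.2 < v.2 ∨ (u.2 = v.2 ∧ le u.1 v.1)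

variable {K : Type*} [Field K] {α : Type*} [AddCancelCommMonoid α] {ι : Type*}

/-- The coefficient of the term `v` in the vector-polynomial `p`. -/
def coeff (p : ι →₀ AddMonoidAlgebra K α) (v : α × ι) : K :=
  (p v.2).coeff v.1

/-- `v` is the leading term of `p` with respect to the order `leT` on terms: the largest term that
occurs in `p` with non-zero coefficient. No term is a leading term of `0`. -/
def IsLeadingTerm (leT : α × ι → α × ι → Prop) (p : ι →₀ AddMonoidAlgebra K α)
    (v : α × ι) : Prop :=
  coeff p v ≠ 0 ∧ ∀ u, coeff p u ≠ 0 → leT u v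

/-- `p` reduces to `q` modulo `f` using the power-product `t`; with `s e_j` the leading term of
`f`, this subtracts from `p` the multiple of `f` that cancels the term `(t s) e_j`. -/
def RedSingle (leT : α × ι → α × ι → Prop) (p q f : ι →₀ AddMonoidAlgebra K α) (t : α) : Prop :=
  ∃ (s : α) (j : ι), IsLeadingTerm leT f (s, j) ∧ coeff p (t + s, j) ≠ 0 ∧
    q = p - AddMonoidAlgebra.single t (coeff p (t + s, j) / coeff f (s, j)) • f

/-- The reduction relation modulo a set `F`. -/
def Red (leT : α × ι → α × ι → Prop) (F : Set (ι →₀ AddMonoidAlgebra K α))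
    (p q : ι →₀ AddMonoidAlgebra K α) : Prop :=
  ∃ f ∈ F, f ≠ 0 ∧ ∃ t : α, RedSingle leT p q f t

/-- `G` is a Groebner basis with respect to `leT` if the reduction relation modulo `G` is
confluent. -/
def IsGroebnerBasis (leT : α × ι → α × ι → Prop) (G : Set (ι →₀ AddMonoidAlgebra K α)) : Prop :=
  ∀ p q r, Relation.ReflTransGen (Red leT G) p q → Relation.ReflTransGen (Red leT G) p r →
    ∃ z, Relation.ReflTransGen (Red leT G) q z ∧ Relation.ReflTransGen (Red leT G) r z

variable {κ : Type*}

/-- The vectors `(e_i, b_i)`, where `bs = [b_0, …, b_{m-1}]`. The type `Fin m ⊕ₗ κ` of indices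
consists of `m` new components followed by all the original ones. -/
def initSyzygyList (bs : List (κ →₀ AddMonoidAlgebra K α)) :
    List ((Fin bs.length ⊕ₗ κ) →₀ AddMonoidAlgebra K α) :=
  List.ofFn fun i : Fin bs.length =>
    Finsupp.single (Sum.inlₗ i) 1 +
      Finsupp.mapDomain (fun j : κ => (Sum.inrₗ j : Fin bs.length ⊕ₗ κ)) (bs.get i)

/-- The restriction of a vector to its first `m` components. -/
def restrictFirst {m : ℕ} (g : (Fin m ⊕ₗ κ) →₀ AddMonoidAlgebra K α) :
    Fin m →₀ AddMonoidAlgebra K α :=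
  Finsupp.equivFunOnFinite.symm fun i => g (Sum.inlₗ i)

open Classical in
/-- Those elements of `gs` of the form `(s_0, …, s_{m-1}, 0, …, 0)`, restricted to
`(s_0, …, s_{m-1})`. -/
def filterSyzygyBasis {m : ℕ} (gs : List ((Fin m ⊕ₗ κ) →₀ AddMonoidAlgebra K α)) :
    List (Fin m →₀ AddMonoidAlgebra K α) :=
  (gs.filter fun g => decide (∀ j : κ, g (Sum.inrₗ j) = 0)).map restrictFirst

/-- The syzygy module of `bs = [b_0, …, b_{m-1}]`: all `(s_0, …, s_{m-1})` such that
`∑ i, s_i b_i = 0`. -/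
def syzygyModule (bs : List (κ →₀ AddMonoidAlgebra K α)) :
    Submodule (AddMonoidAlgebra K α) (Fin bs.length →₀ AddMonoidAlgebra K α) where
  carrier := {s | ∑ i, s i • bs.get i = 0}
  zero_mem' := by simp
  add_mem' := by
    intro a b ha hb
    simp only [Set.mem_ofPred_eq] at ha hb ⊢
    simp only [Finsupp.add_apply, add_smul, Finset.sum_add_distrib, ha, hb, add_zero]
  smul_mem' := by
    intro c a ha
    simp only [Set.mem_ofPred_eq] at ha ⊢
    simp only [Finsupp.smul_apply, smul_eq_mul, mul_smul, ← Finset.smul_sum, ha, smul_zero]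

end GB

end

/-!
A vector `p` and `p + c t g` with `g ∈ G` always have a common reduct modulo `G`. If `G` is a
Gröbner basis, having a common reduct is transitive, so `x` lies in the submodule generated by `G`
iff `x` and `0` have a common reduct, i.e. `x →* 0`. For the position-over-term order, a vector
whose leading term lies in an initial segment of the components vanishes in all later components.
Hence the reductions modulo `G` of a vector supported on the initial segment only use elements of
`G` that are supported there as well; those elements inherit confluence and generate the part of the
submodule that is supported on the initial segment. For the submodule generated by the vectors
`(e_i, b_i)`, which is the graph of `s ↦ ∑ s_i b_i`, the part supported on the new components is
the syzygy module.
-/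

open scoped AddMonoidAlgebra

namespace GB

open Relation

section Reduction

variable {K : Type*} [Field K] {α : Type*} [AddCancelCommMonoid α] {ι : Type*}

theorem coeff_add (p q : ι →₀ K[α]) (v : α × ι) : coeff (p + q) v = coeff p v + coeff q v := by
  simp only [coeff, Finsupp.add_apply, AddMonoidAlgebra.coeff_add]

theorem coeff_single_smul (p : ι →₀ K[α]) (t s : α) (j : ι) (c : K) :
    coeff (AddMonoidAlgebra.single t c • p) (t + s, j) = c * coeff p (s, j) := by
  simp [coeff]

theorem finite_setOf_coeff_ne_zero (p : ι →₀ K[α]) : {v : α × ι | coeff p v ≠ 0}.Finite := by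
  refine (p.support.finite_toSet.biUnion fun j _ =>
    (p j).coeff.support.finite_toSet.prod (Set.finite_singleton j)).subset ?_
  rintro ⟨s, j⟩ (hs : (p j).coeff s ≠ 0)
  have hj : p j ≠ 0 := fun h => hs (by simp [h])
  simpa [hj] using hs

theorem exists_coeff_ne_zero {p : ι →₀ K[α]} {j : ι} (hj : p j ≠ 0) :
    ∃ s, coeff p (s, j) ≠ 0 :=
  Finsupp.ne_iff.1 (mt AddMonoidAlgebra.coeff_eq_zero.1 hj)

theorem exists_isLeadingTerm (leT : α × ι → α × ι → Prop) [Std.Total leT] [IsTrans _ leT]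
    {p : ι →₀ K[α]} (hp : p ≠ 0) : ∃ v, IsLeadingTerm leT p v := by
  obtain ⟨j, hj⟩ := Finsupp.ne_iff.1 hp
  obtain ⟨s, hs⟩ := exists_coeff_ne_zero hj
  have : Nonempty {v | coeff p v ≠ 0} := ⟨⟨(s, j), hs⟩⟩
  have : Finite {v | coeff p v ≠ 0} := finite_setOf_coeff_ne_zero p
  have hdir : Directed leT ((↑) : {v | coeff p v ≠ 0} → α × ι) := fun u v =>
    (Std.Total.total (r := leT) u v).elim (fun h => ⟨v, h, refl_of leT _⟩)
      fun h => ⟨u, refl_of leT _, h⟩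
  obtain ⟨⟨v, hv⟩, hmax⟩ := hdir.finite_le id
  exact ⟨v, hv, fun u hu => hmax ⟨u, hu⟩⟩

variable {leT : α × ι → α × ι → Prop} {F G : Set (ι →₀ K[α])}

theorem sub_mem_span_of_reflTransGen_red {p q : ι →₀ K[α]} (h : ReflTransGen (Red leT F) p q) :
    p - q ∈ Submodule.span K[α] F := by
  induction h with
  | refl => simp
  | tail _ hstep ih =>
    obtain ⟨f, hf, -, t, s, j, -, -, rfl⟩ := hstep
    rw [sub_sub_eq_add_sub, add_sub_right_comm]
    exact add_mem ih (Submodule.smul_mem _ _ (Submodule.subset_span hf))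

theorem not_red_zero (q : ι →₀ K[α]) : ¬ Red leT F 0 q := by
  rintro ⟨f, -, -, t, s, j, -, hc, -⟩
  exact hc (by simp [coeff])

theorem eq_zero_of_reflTransGen_red_zero {q : ι →₀ K[α]} (h : ReflTransGen (Red leT F) 0 q) :
    q = 0 :=
  h.cases_head.elim Eq.symm fun ⟨_, hstep, _⟩ => (not_red_zero _ hstep).elim

theorem reflTransGen_red_sub {f : ι →₀ K[α]} (hf : f ∈ F) (hf0 : f ≠ 0) {s : α} {j : ι}
    (hlt : IsLeadingTerm leT f (s, j)) (p : ι →₀ K[α]) (t : α) :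
    ReflTransGen (Red leT F) p
      (p - AddMonoidAlgebra.single t (coeff p (t + s, j) / coeff f (s, j)) • f) := by
  by_cases h : coeff p (t + s, j) = 0
  · simpa [h] using ReflTransGen.refl
  · exact .single ⟨f, hf, hf0, t, s, j, hlt, h, rfl⟩

variable [Std.Total leT] [IsTrans _ leT]

theorem join_red_add_single_smul {f : ι →₀ K[α]} (hf : f ∈ F) (p : ι →₀ K[α]) (t : α) (c : K) :
    Join (ReflTransGen (Red leT F)) (p + AddMonoidAlgebra.single t c • f) p := by
  by_cases hf0 : f = 0
  · exact ⟨p, by simpa [hf0] using ReflTransGen.refl, .refl⟩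
  obtain ⟨⟨s, j⟩, hlt⟩ := exists_isLeadingTerm leT hf0
  -- Both vectors lie in `p + K t f`, and cancelling `(t + s, j)` takes them to its only element
  -- in which that term has coefficient `0`.
  refine ⟨_, ?_, reflTransGen_red_sub hf hf0 hlt p t⟩
  convert reflTransGen_red_sub hf hf0 hlt (p + AddMonoidAlgebra.single t c • f) t using 1
  rw [coeff_add, coeff_single_smul, add_div, mul_div_cancel_right₀ _ hlt.1,
    AddMonoidAlgebra.single_add, add_smul, add_sub_add_right_eq_sub]

namespace IsGroebnerBasis

theorem join_red_add_smul (hG : IsGroebnerBasis leT G) {g : ι →₀ K[α]} (hg : g ∈ G)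
    (a : K[α]) (p : ι →₀ K[α]) : Join (ReflTransGen (Red leT G)) (p + a • g) p := by
  have hequiv := equivalence_join hG
  induction a using AddMonoidAlgebra.induction_linear generalizing p with
  | zero => exact ⟨p, by simpa using ReflTransGen.refl, .refl⟩
  | add a b ha hb =>
    rw [add_smul, ← add_assoc]
    exact hequiv.trans (hb _) (ha p)
  | single t c => exact join_red_add_single_smul hg p t c

theorem join_red_add_of_mem_span (hG : IsGroebnerBasis leT G) {x : ι →₀ K[α]}
    (hx : x ∈ Submodule.span K[α] G) (p : ι →₀ K[α]) :
    Join (ReflTransGen (Red leT G)) (p + x) p := by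
  have hequiv := equivalence_join hG
  induction hx using Submodule.closure_induction generalizing p with
  | zero => exact ⟨p, by simpa using ReflTransGen.refl, .refl⟩
  | add x y _ _ hx hy =>
    rw [← add_assoc]
    exact hequiv.trans (hy _) (hx p)
  | smul_mem a g hg => exact hG.join_red_add_smul hg a p

theorem mem_span_iff_reflTransGen_red_zero (hG : IsGroebnerBasis leT G) {x : ι →₀ K[α]} :
    x ∈ Submodule.span K[α] G ↔ ReflTransGen (Red leT G) x 0 := by
  constructor
  · intro hx
    obtain ⟨z, hxz, hz⟩ := hG.join_red_add_of_mem_span hx 0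
    rwa [zero_add, eq_zero_of_reflTransGen_red_zero hz] at hxz
  · intro hx
    simpa using sub_mem_span_of_reflTransGen_red hx

end IsGroebnerBasis

end Reduction

section PositionOverTerm

variable {α ι : Type*} {le : α → α → Prop}

instance potLE.instTotal [LinearOrder ι] [Std.Total le] : Std.Total (potLE (ι := ι) le) where
  total u v := by
    rcases lt_trichotomy u.2 v.2 with h | h | h
    · exact .inl (.inl h)
    · exact (Std.Total.total (r := le) u.1 v.1).imp (fun hle => .inr ⟨h, hle⟩)
        fun hle => .inr ⟨h.symm, hle⟩
    · exact .inr (.inl h)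

instance potLE.instIsTrans [Preorder ι] [IsTrans α le] : IsTrans _ (potLE (ι := ι) le) where
  trans u v w := by
    rintro (huv | ⟨huv, huv'⟩) (hvw | ⟨hvw, hvw'⟩)
    · exact .inl (huv.trans hvw)
    · exact .inl (hvw ▸ huv)
    · exact .inl (huv ▸ hvw)
    · exact .inr ⟨huv.trans hvw, _root_.trans huv' hvw'⟩

theorem potLE_initialSeg_iff {μ : Type*} [LT ι] [LT μ] (e : ι ≤i μ) {s t : α} {i j : ι} :
    potLE le (s, e i) (t, e j) ↔ potLE le (s, i) (t, j) := by
  simp only [potLE, e.map_rel_iff, EmbeddingLike.apply_eq_iff_eq]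

end PositionOverTerm

section InitialSegment

variable {K : Type*} [Field K] {α : Type*} [AddCancelCommMonoid α] {ι μ : Type*}

theorem exists_eq_of_coeff_mapDomain_ne_zero {e : ι → μ} {p : ι →₀ K[α]} {s : α} {j : μ}
    (h : coeff (p.mapDomain e) (s, j) ≠ 0) : ∃ i, e i = j := by
  by_contra hj
  exact h (by simp [coeff, Finsupp.mapDomain_of_notMem_range p j hj])

section Embedding

variable {E : Type*} [FunLike E ι μ] [EmbeddingLike E ι μ]

theorem coeff_mapDomain (e : E) (p : ι →₀ K[α]) (s : α) (i : ι) :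
    coeff (p.mapDomain e) (s, e i) = coeff p (s, i) := by
  simp only [coeff, Finsupp.mapDomain_apply (EmbeddingLike.injective e)]

theorem mapDomain_sub_single_smul (e : E) (p f : ι →₀ K[α]) (t : α) (u v : α × ι) :
    (p - AddMonoidAlgebra.single t (coeff p u / coeff f v) • f).mapDomain e =
      p.mapDomain e - AddMonoidAlgebra.single t (coeff (p.mapDomain e) (u.1, e u.2) /
        coeff (f.mapDomain e) (v.1, e v.2)) • f.mapDomain e := by
  rw [Finsupp.mapDomain_sub, Finsupp.mapDomain_smul, coeff_mapDomain, coeff_mapDomain]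

end Embedding

variable [LT ι] [LT μ] {le : α → α → Prop} (e : ι ≤i μ)

theorem isLeadingTerm_mapDomain_iff {f : ι →₀ K[α]} {s : α} {j : ι} :
    IsLeadingTerm (potLE le) (f.mapDomain e) (s, e j) ↔ IsLeadingTerm (potLE le) f (s, j) := by
  simp only [IsLeadingTerm, coeff_mapDomain]
  refine and_congr_right fun _ => ⟨fun h u hu => ?_, ?_⟩
  · rw [← potLE_initialSeg_iff e]
    exact h _ (by rwa [coeff_mapDomain])
  · rintro h ⟨t, i⟩ hu
    obtain ⟨i, rfl⟩ := exists_eq_of_coeff_mapDomain_ne_zero hu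
    rw [coeff_mapDomain] at hu
    exact (potLE_initialSeg_iff e).2 (h _ hu)

theorem IsLeadingTerm.exists_mapDomain_eq {f : μ →₀ K[α]} {s : α} {j : ι}
    (h : IsLeadingTerm (potLE le) f (s, e j)) : ∃ f' : ι →₀ K[α], f'.mapDomain e = f := by
  refine ⟨f.comapDomain e e.injective.injOn, Finsupp.mapDomain_comapDomain _ e.injective _ ?_⟩
  intro i hi
  obtain ⟨t, ht⟩ := exists_coeff_ne_zero (Finsupp.mem_support_iff.1 hi)
  rcases h.2 _ ht with hlt | ⟨heq, -⟩
  · exact e.mem_range_of_rel hlt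
  · exact ⟨j, heq.symm⟩

variable {G : Set (μ →₀ K[α])} {p : ι →₀ K[α]} {q : μ →₀ K[α]}

theorem red_mapDomain_iff :
    Red (potLE le) G (p.mapDomain e) q ↔
      ∃ q', Red (potLE le) (Finsupp.mapDomain e ⁻¹' G) p q' ∧ q'.mapDomain e = q := by
  constructor
  · rintro ⟨f, hf, hf0, t, s, j, hlt, hc, rfl⟩
    obtain ⟨j, rfl⟩ := exists_eq_of_coeff_mapDomain_ne_zero hc
    obtain ⟨f, rfl⟩ := hlt.exists_mapDomain_eq e
    refine ⟨_, ⟨f, hf, ?_, t, s, j, (isLeadingTerm_mapDomain_iff e).1 hlt, ?_, rfl⟩,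
      mapDomain_sub_single_smul e p f t (t + s, j) (s, j)⟩
    · rintro rfl
      exact hf0 Finsupp.mapDomain_zero
    · rwa [coeff_mapDomain] at hc
  · rintro ⟨_, ⟨f, hf, hf0, t, s, j, hlt, hc, rfl⟩, rfl⟩
    refine ⟨f.mapDomain e, hf, ?_, t, s, e j, (isLeadingTerm_mapDomain_iff e).2 hlt, ?_,
      mapDomain_sub_single_smul e p f t (t + s, j) (s, j)⟩
    · exact fun h => hf0 (Finsupp.mapDomain_injective e.injective (by simpa using h))
    · rwa [coeff_mapDomain]

theorem reflTransGen_red_mapDomain_iff :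
    ReflTransGen (Red (potLE le) G) (p.mapDomain e) q ↔
      ∃ q', ReflTransGen (Red (potLE le) (Finsupp.mapDomain e ⁻¹' G)) p q' ∧
        q'.mapDomain e = q := by
  constructor
  · intro h
    induction h with
    | refl => exact ⟨p, .refl, rfl⟩
    | tail _ hstep ih =>
      obtain ⟨q, hpq, rfl⟩ := ih
      obtain ⟨r, hqr, rfl⟩ := (red_mapDomain_iff e).1 hstep
      exact ⟨r, hpq.tail hqr, rfl⟩
  · rintro ⟨q, hpq, rfl⟩
    exact hpq.lift (Finsupp.mapDomain e) fun _ r h => (red_mapDomain_iff e).2 ⟨r, h, rfl⟩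

theorem IsGroebnerBasis.preimage_mapDomain (hG : IsGroebnerBasis (potLE le) G) :
    IsGroebnerBasis (potLE le) (Finsupp.mapDomain e ⁻¹' G) := by
  intro p q r hpq hpr
  obtain ⟨z, hqz, hrz⟩ := hG _ _ _ ((reflTransGen_red_mapDomain_iff e).2 ⟨q, hpq, rfl⟩)
    ((reflTransGen_red_mapDomain_iff e).2 ⟨r, hpr, rfl⟩)
  obtain ⟨w, hqw, rfl⟩ := (reflTransGen_red_mapDomain_iff e).1 hqz
  obtain ⟨w', hrw, hw⟩ := (reflTransGen_red_mapDomain_iff e).1 hrz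
  obtain rfl := Finsupp.mapDomain_injective e.injective hw
  exact ⟨w', hqw, hrw⟩

end InitialSegment

theorem IsGroebnerBasis.mem_span_preimage_mapDomain_iff {K : Type*} [Field K] {α : Type*}
    [AddCancelCommMonoid α] {ι μ : Type*} [LinearOrder ι] [LinearOrder μ] {le : α → α → Prop}
    [Std.Total le] [IsTrans α le] (e : ι ≤i μ) {G : Set (μ →₀ K[α])}
    (hG : IsGroebnerBasis (potLE le) G) {p : ι →₀ K[α]} :
    p ∈ Submodule.span K[α] (Finsupp.mapDomain e ⁻¹' G) ↔
      p.mapDomain e ∈ Submodule.span K[α] G := by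
  rw [hG.mem_span_iff_reflTransGen_red_zero,
    (hG.preimage_mapDomain e).mem_span_iff_reflTransGen_red_zero,
    reflTransGen_red_mapDomain_iff]
  constructor
  · exact fun h => ⟨0, h, Finsupp.mapDomain_zero⟩
  · rintro ⟨q, hpq, hq⟩
    rwa [Finsupp.mapDomain_injective e.injective (hq.trans Finsupp.mapDomain_zero.symm)] at hpq

section LexSum

/-- The index set `ι` as the initial segment of new components in `ι ⊕ₗ κ`. -/
def inlInitialSeg (ι κ : Type*) [LT ι] [LT κ] : ι ≤i ι ⊕ₗ κ where
  toFun i := Sum.inlₗ i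
  inj' := toLex.injective.comp Sum.inl_injective
  map_rel_iff' := Sum.Lex.inl_lt_inl_iff
  mem_range_of_rel' i j h := by
    induction j using Lex.rec with | _ j
    rcases j with j | j
    · exact ⟨j, rfl⟩
    · exact absurd h Sum.Lex.not_inr_lt_inl

variable {R M : Type*} [Semiring R] [AddCommMonoid M] {ι κ : Type*}

theorem mapDomain_inlₗ_apply_inlₗ (p : ι →₀ M) (i : ι) :
    p.mapDomain (fun i => (Sum.inlₗ i : ι ⊕ₗ κ)) (Sum.inlₗ i) = p i :=
  Finsupp.mapDomain_apply (toLex.injective.comp Sum.inl_injective) p i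

theorem mapDomain_inlₗ_apply_inrₗ (p : ι →₀ M) (j : κ) :
    p.mapDomain (fun i => (Sum.inlₗ i : ι ⊕ₗ κ)) (Sum.inrₗ j) = 0 :=
  Finsupp.mapDomain_of_notMem_range _ _ (by simp)

theorem mapDomain_inrₗ_apply_inlₗ (p : κ →₀ M) (i : ι) :
    p.mapDomain (fun j => (Sum.inrₗ j : ι ⊕ₗ κ)) (Sum.inlₗ i) = 0 :=
  Finsupp.mapDomain_of_notMem_range _ _ (by simp)

theorem mapDomain_inrₗ_apply_inrₗ (p : κ →₀ M) (j : κ) :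
    p.mapDomain (fun j => (Sum.inrₗ j : ι ⊕ₗ κ)) (Sum.inrₗ j) = p j :=
  Finsupp.mapDomain_apply (toLex.injective.comp Sum.inr_injective) p j

/-- The vector `(e_i, b_i)`; these vectors generate the graph of the linear map `s ↦ ∑ s_i b_i`. -/
noncomputable def graphVector (b : ι → κ →₀ R) (i : ι) : (ι ⊕ₗ κ) →₀ R :=
  Finsupp.single (Sum.inlₗ i) 1 + (b i).mapDomain fun j => Sum.inrₗ j

theorem linearCombination_graphVector (b : ι → κ →₀ R) (s : ι →₀ R) :
    Finsupp.linearCombination R (graphVector b) s =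
      s.mapDomain (fun i => Sum.inlₗ i) +
        (Finsupp.linearCombination R b s).mapDomain fun j => Sum.inrₗ j := by
  induction s using Finsupp.induction_linear with
  | zero => simp
  | add s t hs ht =>
    rw [map_add, map_add, hs, ht, Finsupp.mapDomain_add, Finsupp.mapDomain_add, add_add_add_comm]
  | single i a => simp [graphVector, Finsupp.mapDomain_smul]

theorem mapDomain_inlₗ_mem_span_graphVector_iff (b : ι → κ →₀ R) {p : ι →₀ R} :
    p.mapDomain (fun i => Sum.inlₗ i) ∈ Submodule.span R (Set.range (graphVector b)) ↔
      p ∈ LinearMap.ker (Finsupp.linearCombination R b) := by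
  rw [← Finsupp.range_linearCombination, LinearMap.mem_range, LinearMap.mem_ker]
  simp only [linearCombination_graphVector]
  constructor
  · rintro ⟨s, hs⟩
    obtain rfl : s = p := by
      ext i
      simpa [mapDomain_inlₗ_apply_inlₗ, mapDomain_inrₗ_apply_inlₗ] using
        DFunLike.congr_fun hs (Sum.inlₗ i)
    ext j
    simpa [mapDomain_inlₗ_apply_inrₗ, mapDomain_inrₗ_apply_inrₗ] using
      DFunLike.congr_fun hs (Sum.inrₗ j)
  · intro hp
    exact ⟨p, by rw [hp, Finsupp.mapDomain_zero, add_zero]⟩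

end LexSum

section SyzygyList

variable {K : Type*} [Field K] {α : Type*} [AddCancelCommMonoid α] {κ : Type*}

theorem setOf_mem_initSyzygyList (bs : List (κ →₀ K[α])) :
    {v | v ∈ initSyzygyList bs} = Set.range (graphVector bs.get) := by
  ext v
  exact List.mem_ofFn

theorem setOf_mem_filterSyzygyBasis {m : ℕ} (gs : List ((Fin m ⊕ₗ κ) →₀ K[α])) :
    {s | s ∈ filterSyzygyBasis gs} =
      Finsupp.mapDomain (fun i => Sum.inlₗ i) ⁻¹' {g | g ∈ gs} := by
  ext s
  simp only [filterSyzygyBasis, Set.mem_ofPred_eq, Set.mem_preimage, List.mem_map, List.mem_filter,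
    decide_eq_true_eq]
  constructor
  · rintro ⟨g, ⟨hg, hg0⟩, rfl⟩
    convert hg
    ext1 i
    induction i using Lex.rec with | _ i
    rcases i with i | j
    · exact mapDomain_inlₗ_apply_inlₗ _ i
    · exact (mapDomain_inlₗ_apply_inrₗ _ j).trans (hg0 j).symm
  · intro hs
    exact ⟨_, ⟨hs, mapDomain_inlₗ_apply_inrₗ s⟩, Finsupp.ext (mapDomain_inlₗ_apply_inlₗ s)⟩

theorem syzygyModule_eq_ker (bs : List (κ →₀ K[α])) :
    syzygyModule bs = LinearMap.ker (Finsupp.linearCombination K[α] bs.get) := by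
  ext s
  rw [LinearMap.mem_ker, Finsupp.linearCombination_apply, Finsupp.sum_fintype _ _ (by simp)]
  rfl

end SyzygyList

end GB

theorem mainTheorem6_general {K : Type*} [Field K] {α : Type*} [AddCancelCommMonoid α]
    (le : α → α → Prop) [Std.Total le] [IsTrans α le]
    {ι κ : Type*} [LinearOrder ι] [LinearOrder κ] (b : ι → κ →₀ K[α])
    (G : Set ((ι ⊕ₗ κ) →₀ K[α])) (hG : GB.IsGroebnerBasis (GB.potLE le) G)
    (hspan : Submodule.span K[α] G = Submodule.span K[α] (Set.range (GB.graphVector b))) :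
    Submodule.span K[α] (Finsupp.mapDomain (fun i => Sum.inlₗ i) ⁻¹' G) =
        LinearMap.ker (Finsupp.linearCombination K[α] b) ∧
      GB.IsGroebnerBasis (GB.potLE le) (Finsupp.mapDomain (fun i => Sum.inlₗ i) ⁻¹' G) := by
  refine ⟨?_, hG.preimage_mapDomain (GB.inlInitialSeg ι κ)⟩
  ext p
  rw [← GB.mapDomain_inlₗ_mem_span_graphVector_iff, ← hspan]
  exact hG.mem_span_preimage_mapDomain_iff (GB.inlInitialSeg ι κ)

theorem mainTheorem6 {K : Type*} [Field K] {α : Type*} [AddCancelCommMonoid α]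
    (le : α → α → Prop) (hle : GB.IsAdmissible le)
    {κ : Type*} [LinearOrder κ]
    (bs : List (κ →₀ AddMonoidAlgebra K α)) (hbs : bs.Nodup)
    (gs : List ((Fin bs.length ⊕ₗ κ) →₀ AddMonoidAlgebra K α))
    (hgs : GB.IsGroebnerBasis (GB.potLE le) {g | g ∈ gs})
    (hspan : Submodule.span (AddMonoidAlgebra K α) {g | g ∈ gs} =
      Submodule.span (AddMonoidAlgebra K α) {b | b ∈ GB.initSyzygyList bs}) :
    Submodule.span (AddMonoidAlgebra K α) {s | s ∈ GB.filterSyzygyBasis gs} =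
        GB.syzygyModule bs ∧
      GB.IsGroebnerBasis (GB.potLE le) {s | s ∈ GB.filterSyzygyBasis gs} := by
  have : Std.Total le := ⟨hle.total⟩
  have : IsTrans α le := ⟨hle.trans⟩
  rw [GB.setOf_mem_initSyzygyList] at hspan
  rw [GB.setOf_mem_filterSyzygyBasis, GB.syzygyModule_eq_ker]
  exact mainTheorem6_general le bs.get _ hgs hspan
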